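/- All rings are commutative with identity. Let $R$ be a ring, $M$ an $R$-module and $\mathbf{x}=x_1,\dots,x_\ell$ a finite sequence in $R$. The sequence $\mathbf{x}$ is \emph{$M$-weakly proregular} if for each $n$ there is $m\ge n$ such that the natural map of Koszul homology modules $H_i(\mathbf{x}^m,M)\to H_i(\mathbf{x}^n,M)$ is zero for all $i\ge 1$. It is a \emph{parameter sequence on $M$} if it is $M$-weakly proregular, $\mathbf{x}M\ne M$, and the top \v{C}ech cohomology satisfies $H^{\ell}_{\mathbf{x}}(M)_{\mathfrak p}\ne 0$ for every prime $\mathfrak p\in\operatorname{Supp}_R(M/\mathbf{x}M)$. It is a \emph{strong parameter sequence on $M$} if $x_1,\dots,x_i$ is a parameter sequence on $M$ for all $i=1,\dots,\ell$. The module $M$ is \emph{Cohen--Macaulay} if every strong parameter sequence on $M$ is an $M$-regular sequence (the empty sequence counts as regular on every module). (1) Let $R\to S$ be a faithfully flat ring homomorphism and $M$ an $R$-module. If $M\otimes_R S$ is a Cohen--Macaulay $S$-module, then $M$ is a Cohen--Macaulay $R$-module. (2) Let $(R,\mathfrak m)$ be a quasi-local ring whose $\mathfrak m$-adic completion $\widehat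 R$ is flat over $R$; in particular, $(R,\mathfrak m)$ may be any Noetherian local ring. Let $M$ be an $R$-module. If $M\otimes_R\widehat R$ is a Cohen--Macaulay $\widehat R$-module, then $M$ is a Cohen--Macaulay $R$-module. (3) Let $R$ be a ring, $M$ an $R$-module and $t$ an indeterminate over $R$. If $M\otimes_R R[t]$ is a Cohen--Macaulay $R[t]$-module, then $M$ is a Cohen--Macaulay $R$-module. -/

import Mathlib

open scoped TensorProduct

universe u v w

noncomputable section

namespace HMCohenMacaulay

/-- The position sign `(-1)^{#{k ∈ T : k < j}}`. -/
def posSign (R : Type*) [CommRing R] {l : ℕ} (T : Finset (Fin l)) (j : Fin l) : R :=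
  (-1) ^ (T.filter (· < j)).card

theorem posSign_insert (R : Type*) [CommRing R] {l : ℕ} (T : Finset (Fin l)) {j k : Fin l}
    (hj : j ∉ T) :
    posSign R (insert j T) k = (if j < k then -1 else 1) * posSign R T k := by
  unfold posSign
  rw [Finset.filter_insert]
  split_ifs with h
  · rw [Finset.card_insert_of_notMem (by simp [hj]), pow_succ, mul_comm]
  · rw [one_mul]

theorem posSign_swap (R : Type*) [CommRing R] {l : ℕ} (T : Finset (Fin l)) {j k : Fin l}
    (hj : j ∉ T) (hk : k ∉ T) (hjk : j ≠ k) :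
    posSign R T j * posSign R (insert j T) k + posSign R T k * posSign R (insert k T) j = 0 := by
  rw [posSign_insert R T hj, posSign_insert R T hk]
  rcases lt_or_gt_of_ne hjk with h | h
  · rw [if_pos h, if_neg h.not_gt]; ring
  · rw [if_pos h, if_neg h.not_gt]; ring

/-! ### The Koszul complex -/

/-- The subsets of `{0, …, l-1}` with `i` elements; they index the standard basis
`e_T = e_{t₁} ∧ ⋯ ∧ e_{tᵢ}` of the degree `i` part of the Koszul complex. -/
abbrev Subsets (l i : ℕ) : Type := {T : Finset (Fin l) // T.card = i}

section Koszul

variable {R : Type*} [CommRing R] {l : ℕ} (x : Fin l → R) (M : Type*) [AddCommGroup M] [Module R M]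

/-- The differential `K_{i+1}(x, M) → K_i(x, M)` of the Koszul complex, where
`K_i(x, M) = ⨁_{|T| = i} M e_T`. It sends
`m e_{t₀} ∧ ⋯ ∧ e_{tᵢ}` to `∑ₖ (-1)ᵏ x_{tₖ} m e_{t₀} ∧ ⋯ (omit e_{tₖ}) ⋯ ∧ e_{tᵢ}`. -/
def koszulD (i : ℕ) : (Subsets l (i + 1) → M) →ₗ[R] (Subsets l i → M) :=
  LinearMap.pi fun T => ∑ j : {j : Fin l // j ∉ T.1},
    (posSign R T.1 j.1 * x j.1) •
      LinearMap.proj (R := R) (φ := fun _ : Subsets l (i + 1) => M)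
        ⟨insert j.1 T.1, by rw [Finset.card_insert_of_notMem j.2, T.2]⟩

theorem koszulD_apply (i : ℕ) (f : Subsets l (i + 1) → M) (T : Subsets l i) :
    koszulD x M i f T = ∑ j : {j : Fin l // j ∉ T.1}, (posSign R T.1 j.1 * x j.1) •
      f ⟨insert j.1 T.1, by rw [Finset.card_insert_of_notMem j.2, T.2]⟩ := by
  simp [koszulD, LinearMap.sum_apply]

theorem koszulD_comp (i : ℕ) : koszulD x M i ∘ₗ koszulD x M (i + 1) = 0 := by
  refine LinearMap.ext fun f => ?_
  funext T
  simp only [LinearMap.comp_apply, koszulD_apply, Finset.smul_sum, smul_smul]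
  rw [Finset.sum_sigma', LinearMap.zero_apply, Pi.zero_apply]
  have h1 : ∀ a : (j : {j : Fin l // j ∉ T.1}) × {k : Fin l // k ∉ insert j.1 T.1},
      a.2.1 ∉ T.1 := fun a h => a.2.2 (Finset.mem_insert_of_mem h)
  have h2 : ∀ a : (j : {j : Fin l // j ∉ T.1}) × {k : Fin l // k ∉ insert j.1 T.1},
      a.1.1 ≠ a.2.1 := fun a h => a.2.2 (h ▸ Finset.mem_insert_self _ _)
  refine Finset.sum_involution
    (fun a _ => ⟨⟨a.2.1, h1 a⟩, ⟨a.1.1, by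
      simpa [Finset.mem_insert] using ⟨h2 a, a.1.2⟩⟩⟩) ?_ ?_ ?_ ?_
  · intro a _
    dsimp only
    have e : (insert a.1.1 (insert a.2.1 T.1)) = insert a.2.1 (insert a.1.1 T.1) :=
      Finset.insert_comm _ _ _
    simp only [e, ← add_smul]
    convert zero_smul R _ using 2
    linear_combination (x a.1.1 * x a.2.1) * posSign_swap R T.1 a.1.2 (h1 a) (h2 a)
  · intro a _ _ h
    exact h2 a (congrArg (fun b => b.1.1) h).symm
  · intro a _; simp
  · intro a _; rfl

/-- The cycles in degree `i` of the Koszul complex. -/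
def koszulCycles : (i : ℕ) → Submodule R (Subsets l i → M)
  | 0 => ⊤
  | i + 1 => LinearMap.ker (koszulD x M i)

/-- Koszul homology `H_i(x, M)`: cycles modulo boundaries. -/
abbrev KoszulHomology (i : ℕ) : Type _ :=
  koszulCycles x M i ⧸ (LinearMap.range (koszulD x M i)).submoduleOf (koszulCycles x M i)

/-- The degree `i` component `K_i(x^m, M) → K_i(x^n, M)` of the chain map `φ_n^m` (for `n ≤ m`):
it is the tensor product of the maps which are `x_j^{m-n}` in degree `1` and the identity in
degree `0`, so that `m e_T` is sent to `(∏_{j ∈ T} x_j^{m-n}) m e_T`. -/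
def koszulPow (m n i : ℕ) : (Subsets l i → M) →ₗ[R] (Subsets l i → M) :=
  LinearMap.pi fun T => (∏ j ∈ T.1, x j ^ (m - n)) •
    LinearMap.proj (R := R) (φ := fun _ : Subsets l i => M) T

theorem koszulPow_comm {m n : ℕ} (h : n ≤ m) (i : ℕ) :
    koszulD (fun j => x j ^ n) M i ∘ₗ koszulPow x M m n (i + 1) =
      koszulPow x M m n i ∘ₗ koszulD (fun j => x j ^ m) M i := by
  refine LinearMap.ext fun f => ?_
  funext T
  simp only [LinearMap.comp_apply, koszulPow, koszulD_apply, LinearMap.pi_apply,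
    LinearMap.smul_apply, LinearMap.proj_apply, Finset.smul_sum, smul_smul]
  refine Finset.sum_congr rfl fun j _ => ?_
  congr 1
  rw [Finset.prod_insert j.2, ← Nat.add_sub_cancel' h, pow_add, Nat.add_sub_cancel_left]
  ring

theorem koszulPow_mem_cycles {m n : ℕ} (h : n ≤ m) : ∀ (i : ℕ) (f : Subsets l i → M),
    f ∈ koszulCycles (fun j => x j ^ m) M i →
      koszulPow x M m n i f ∈ koszulCycles (fun j => x j ^ n) M i
  | 0, _, _ => Submodule.mem_top
  | i + 1, f, hf => by
    have := LinearMap.congr_fun (koszulPow_comm x M h i) f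
    simp only [LinearMap.comp_apply] at this
    change koszulD _ M i f = 0 at hf
    change koszulD _ M i _ = 0
    rw [this, hf, map_zero]

/-- The map `H_i(x^m, M) → H_i(x^n, M)` induced by the chain map `φ_n^m`, for `n ≤ m`. -/
def koszulHomologyMap {m n : ℕ} (h : n ≤ m) (i : ℕ) :
    KoszulHomology (fun j => x j ^ m) M i →ₗ[R] KoszulHomology (fun j => x j ^ n) M i :=
  Submodule.mapQ _ _ ((koszulPow x M m n i).restrict (koszulPow_mem_cycles x M h i)) (by
    rintro ⟨f, hf⟩ ⟨g, hg⟩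
    refine ⟨koszulPow x M m n (i + 1) g, ?_⟩
    have := LinearMap.congr_fun (koszulPow_comm x M h i) g
    simp only [LinearMap.comp_apply] at this
    rw [this, hg]
    rfl)

/-- The finite sequence `x` is `M`-weakly proregular. -/
def IsWeaklyProregular : Prop :=
  ∀ n : ℕ, ∃ (m : ℕ) (h : n ≤ m), ∀ i : ℕ, 1 ≤ i → koszulHomologyMap x M h i = 0

end Koszul

/-! ### The Čech complex -/

section Cech

variable {R : Type*} [CommRing R] {l : ℕ} (x : Fin l → R) (M : Type*) [AddCommGroup M] [Module R M]

/-- The localization of `M` at the multiplicative set generated by the `x_j` with `j ∈ T`,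
that is, the localization `M_{x_T}` with `x_T = ∏_{j ∈ T} x_j`. -/
abbrev CechTerm (T : Finset (Fin l)) : Type _ :=
  LocalizedModule (Submonoid.closure (x '' (T : Set (Fin l)))) M

/-- The canonical map `M_{x_U} → M_{x_T}` for `U ⊆ T`. -/
def cechRes {U T : Finset (Fin l)} (h : U ⊆ T) : CechTerm x M U →ₗ[R] CechTerm x M T :=
  LocalizedModule.liftOfLE _ _ (Submonoid.closure_mono (Set.image_mono (Finset.coe_subset.2 h)))

/-- The differential `C^i(x; M) → C^{i+1}(x; M)` of the Čech complex, where
`C^i(x; M) = ⨁_{|T| = i} M_{x_T}`: an alternating sum of canonical localization maps. -/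
def cechD (i : ℕ) : ((T : Subsets l i) → CechTerm x M T.1) →ₗ[R]
    ((T : Subsets l (i + 1)) → CechTerm x M T.1) :=
  LinearMap.pi fun T => ∑ j : {j : Fin l // j ∈ T.1},
    posSign R T.1 j.1 • (cechRes x M (Finset.erase_subset j.1 T.1) ∘ₗ
      LinearMap.proj (R := R) (φ := fun U : Subsets l i => CechTerm x M U.1)
        ⟨T.1.erase j.1, by rw [Finset.card_erase_of_mem j.2, T.2, Nat.add_sub_cancel]⟩)

theorem cechD_apply (i : ℕ) (f : (T : Subsets l i) → CechTerm x M T.1) (T : Subsets l (i + 1)) :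
    cechD x M i f T = ∑ j : {j : Fin l // j ∈ T.1},
      posSign R T.1 j.1 • cechRes x M (Finset.erase_subset j.1 T.1)
        (f ⟨T.1.erase j.1, by rw [Finset.card_erase_of_mem j.2, T.2, Nat.add_sub_cancel]⟩) := by
  simp [cechD, LinearMap.sum_apply]

theorem cechRes_cechRes {U V T : Finset (Fin l)} (h : U ⊆ V) (h' : V ⊆ T) (m : CechTerm x M U) :
    cechRes x M h' (cechRes x M h m) = cechRes x M (h.trans h') m := by
  obtain ⟨⟨a, s⟩, rfl⟩ := IsLocalizedModule.mk'_surjective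
    (Submonoid.closure (x '' (U : Set (Fin l)))) (LocalizedModule.mkLinearMap _ M) m
  simp [cechRes, LocalizedModule.liftOfLE]

theorem cechD_comp (i : ℕ) : cechD x M (i + 1) ∘ₗ cechD x M i = 0 := by
  refine LinearMap.ext fun f => ?_
  funext T
  simp only [LinearMap.comp_apply, cechD_apply, map_sum, map_smul, Finset.smul_sum, smul_smul,
    cechRes_cechRes]
  rw [Finset.sum_sigma', LinearMap.zero_apply, Pi.zero_apply]
  have h1 : ∀ a : (j : {j : Fin l // j ∈ T.1}) × {k : Fin l // k ∈ T.1.erase j.1},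
      a.2.1 ∈ T.1 := fun a => Finset.mem_of_mem_erase a.2.2
  have h2 : ∀ a : (j : {j : Fin l // j ∈ T.1}) × {k : Fin l // k ∈ T.1.erase j.1},
      a.1.1 ≠ a.2.1 := fun a => (Finset.ne_of_mem_erase a.2.2).symm
  have key : ∀ (U V : Subsets l i) (hU : U.1 ⊆ T.1) (hV : V.1 ⊆ T.1), U = V →
      cechRes x M hU (f U) = cechRes x M hV (f V) := by
    rintro U V hU hV rfl; rfl
  refine Finset.sum_involution
    (fun a _ => ⟨⟨a.2.1, h1 a⟩, ⟨a.1.1, Finset.mem_erase.2 ⟨h2 a, a.1.2⟩⟩⟩) ?_ ?_ ?_ ?_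
  · intro a _
    dsimp only
    set W := (T.1.erase a.1.1).erase a.2.1 with hW
    have eW : (T.1.erase a.2.1).erase a.1.1 = W := Finset.erase_right_comm
    have n1 : a.1.1 ∉ W := by simp [hW]
    have n2 : a.2.1 ∉ W := by simp [hW]
    have e1 : T.1.erase a.1.1 = insert a.2.1 W := (Finset.insert_erase a.2.2).symm
    have e2 : T.1.erase a.2.1 = insert a.1.1 W := by
      rw [← eW, Finset.insert_erase (Finset.mem_erase.2 ⟨h2 a, a.1.2⟩)]
    have e3 : T.1 = insert a.1.1 (insert a.2.1 W) := by
      rw [← e1, Finset.insert_erase a.1.2]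
    have cW : W.card = i := by
      rw [hW, Finset.card_erase_of_mem a.2.2, Finset.card_erase_of_mem a.1.2, T.2]; omega
    rw [key ⟨(T.1.erase a.2.1).erase a.1.1, _⟩ ⟨W, cW⟩ _
      ((Finset.erase_subset _ _).trans (Finset.erase_subset _ _)) (Subtype.ext eW), ← add_smul]
    convert zero_smul R _ using 2
    have s1 : posSign R T.1 a.1.1 = posSign R (insert a.2.1 W) a.1.1 :=
      (congrArg (fun V => posSign R V a.1.1) e3).trans (by
        rw [posSign_insert R _ (by simp [n1, h2 a]), if_neg (lt_irrefl _), one_mul])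
    have s2 : posSign R T.1 a.2.1 = posSign R (insert a.1.1 W) a.2.1 :=
      (congrArg (fun V => posSign R V a.2.1) (e3.trans (Finset.insert_comm _ _ _))).trans (by
        rw [posSign_insert R _ (by simp [n2, (h2 a).symm]), if_neg (lt_irrefl _), one_mul])
    have t1 : posSign R (T.1.erase a.1.1) a.2.1 = posSign R W a.2.1 :=
      (congrArg (fun V => posSign R V a.2.1) e1).trans (by
        rw [posSign_insert R _ n2, if_neg (lt_irrefl _), one_mul])
    have t2 : posSign R (T.1.erase a.2.1) a.1.1 = posSign R W a.1.1 :=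
      (congrArg (fun V => posSign R V a.1.1) e2).trans (by
        rw [posSign_insert R _ n1, if_neg (lt_irrefl _), one_mul])
    rw [s1, s2, t1, t2]
    linear_combination posSign_swap R W n1 n2 (h2 a)
  · intro a _ _ h
    exact h2 a (congrArg (fun b => b.1.1) h).symm
  · intro a _; simp
  · intro a _; rfl

/-- The coboundaries in degree `i` of the Čech complex. -/
def cechCoboundaries : (i : ℕ) → Submodule R ((T : Subsets l i) → CechTerm x M T.1)
  | 0 => ⊥
  | i + 1 => LinearMap.range (cechD x M i)

/-- Čech cohomology `H^i_x(M)`: cocycles modulo coboundaries. -/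
abbrev CechCohomology (i : ℕ) : Type _ :=
  LinearMap.ker (cechD x M i) ⧸ (cechCoboundaries x M i).submoduleOf (LinearMap.ker (cechD x M i))

end Cech

/-! ### Parameter sequences and Cohen–Macaulay modules -/

section CohenMacaulay

variable {R : Type*} [CommRing R] {l : ℕ} (x : Fin l → R) (M : Type*) [AddCommGroup M] [Module R M]

/-- The submodule `xM` of `M`. -/
def seqSMul : Submodule R M := Ideal.span (Set.range x) • (⊤ : Submodule R M)

/-- `x` is a parameter sequence on `M`. -/
structure IsParameterSequence : Prop where
  weaklyProregular : IsWeaklyProregular x M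
  ne_top : seqSMul x M ≠ ⊤
  cech_ne_zero : ∀ p ∈ Module.support R (M ⧸ seqSMul x M),
    Nontrivial (LocalizedModule p.asIdeal.primeCompl (CechCohomology x M l))

/-- `x` is a strong parameter sequence on `M`: every initial part `x₁, …, xᵢ` with
`1 ≤ i ≤ l` is a parameter sequence on `M`. (The empty sequence is one on every module.) -/
def IsStrongParameterSequence : Prop :=
  ∀ (i : ℕ) (h : i ≤ l), 1 ≤ i → IsParameterSequence (fun j : Fin i => x (Fin.castLE h j)) M

/-- `x` is an `M`-regular sequence; the empty sequence counts as regular on every module,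
including the zero module. -/
def IsRegularSequence : Prop :=
  l = 0 ∨ RingTheory.Sequence.IsRegular M (List.ofFn x)

variable (R) in
/-- `M` is a Cohen–Macaulay `R`-module (in the sense of Hamilton and Marley): every strong
parameter sequence on `M` is an `M`-regular sequence. -/
def IsCohenMacaulay : Prop :=
  ∀ (l : ℕ) (x : Fin l → R), IsStrongParameterSequence x M → IsRegularSequence x M

end CohenMacaulay

end HMCohenMacaulay

end

/-!
Let `S` be a faithfully flat `R`-algebra and `x` a strong parameter sequence on `M`. Termwise, the
Koszul and Čech complexes of the image of `x` on `S ⊗ M` are the base changes of those of `x` on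
`M`. Flatness gives the same for their (co)homology, so weak proregularity passes to `S ⊗ M`. For
flat `S` the support of `S ⊗ N` is the preimage of the support of `N`, since
`Ann (1 ⊗ n) = (Ann n) S`. The nonvanishing of top Čech cohomology says that
`Supp (M / xM) ⊆ Supp (H^l_x M)`, so it passes to `S ⊗ M` too. Hence the image of `x` is a strong
parameter sequence on `S ⊗ M`, therefore regular, and regularity descends along `R → S`.
-/

noncomputable section

namespace HMCohenMacaulay

section LinearAlgebra

variable {R : Type*} [CommRing R] (S : Type*) [CommRing S] [Algebra R S]
  {M N : Type*} [AddCommGroup M] [Module R M] [AddCommGroup N] [Module R N]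

theorem map_subtype_submoduleOf {L Z : Submodule R M} (hLZ : L ≤ Z) :
    (L.submoduleOf Z).map Z.subtype = L := by
  rw [Submodule.submoduleOf, Submodule.map_comap_subtype, inf_of_le_right hLZ]

theorem baseChange_map (f : M →ₗ[R] N) (p : Submodule R M) :
    (p.map f).baseChange S = (p.baseChange S).map (f.baseChange S) := by
  simp only [Submodule.baseChange_eq_span, Submodule.map_span, Submodule.map_coe, Set.image_image,
    TensorProduct.mk_apply, LinearMap.baseChange_tmul]

theorem baseChange_range (f : M →ₗ[R] N) :
    (LinearMap.range f).baseChange S = LinearMap.range (f.baseChange S) := by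
  rw [LinearMap.range_eq_map, baseChange_map, Submodule.baseChange_top, LinearMap.range_eq_map]

theorem baseChange_ker [Module.Flat R S] (f : M →ₗ[R] N) :
    (LinearMap.ker f).baseChange S = LinearMap.ker (f.baseChange S) :=
  SetLike.ext fun z =>
    (Module.Flat.lTensor_exact S (LinearMap.exact_subtype_ker_map f) z).symm

variable {S}

section Conjugate

variable {M' N' : Type*} [AddCommGroup M'] [Module S M'] [AddCommGroup N'] [Module S N']
  {f : M →ₗ[R] N} {f' : M' →ₗ[S] N'} {eM : S ⊗[R] M ≃ₗ[S] M'} {eN : S ⊗[R] N ≃ₗ[S] N'}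

theorem map_baseChange_range (h : f' ∘ₗ eM = eN ∘ₗ f.baseChange S) :
    ((LinearMap.range f).baseChange S).map (eN : S ⊗[R] N →ₗ[S] N') = LinearMap.range f' := by
  rw [baseChange_range, ← LinearMap.range_comp, ← h, LinearEquiv.range_comp]

theorem map_baseChange_ker [Module.Flat R S] (h : f' ∘ₗ eM = eN ∘ₗ f.baseChange S) :
    ((LinearMap.ker f).baseChange S).map (eM : S ⊗[R] M →ₗ[S] M') = LinearMap.ker f' := by
  rw [baseChange_ker, ← LinearEquiv.ker_comp eN, ← h, LinearMap.ker_comp]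
  exact Submodule.map_comap_eq_of_surjective eM.surjective _

/-- The identification of `S ⊗ Z` with the submodule `Z'` that `Z` generates in `M' ≅ S ⊗ M`. -/
def submoduleBaseChange [Module.Flat R S] {Z : Submodule R M} {Z' : Submodule S M'}
    (e : S ⊗[R] M ≃ₗ[S] M') (hZ : (Z.baseChange S).map (e : S ⊗[R] M →ₗ[S] M') = Z') :
    S ⊗[R] Z ≃ₗ[S] Z' :=
  Submodule.toBaseChange.toLinearEquiv S Z ≪≫ₗ e.submoduleMap _ ≪≫ₗ LinearEquiv.ofEq _ _ hZ

theorem subtype_comp_submoduleBaseChange [Module.Flat R S] {Z : Submodule R M}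
    {Z' : Submodule S M'} (e : S ⊗[R] M ≃ₗ[S] M')
    (hZ : (Z.baseChange S).map (e : S ⊗[R] M →ₗ[S] M') = Z') :
    Z'.subtype ∘ₗ submoduleBaseChange e hZ = e.toLinearMap ∘ₗ Z.subtype.baseChange S :=
  rfl

theorem map_submoduleBaseChange_submoduleOf [Module.Flat R S] {L Z : Submodule R M}
    {L' Z' : Submodule S M'} (hLZ : L ≤ Z) (e : S ⊗[R] M ≃ₗ[S] M')
    (hL : (L.baseChange S).map (e : S ⊗[R] M →ₗ[S] M') = L')
    (hZ : (Z.baseChange S).map (e : S ⊗[R] M →ₗ[S] M') = Z') :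
    ((L.submoduleOf Z).baseChange S).map (submoduleBaseChange e hZ).toLinearMap =
      L'.submoduleOf Z' := by
  have hLZ' : L' ≤ Z' := hL ▸ hZ ▸ Submodule.map_mono (Submodule.baseChange_mono S hLZ)
  apply Submodule.map_injective_of_injective Z'.injective_subtype
  rw [← Submodule.map_comp, subtype_comp_submoduleBaseChange, Submodule.map_comp,
    ← baseChange_map, map_subtype_submoduleOf hLZ, hL, map_subtype_submoduleOf hLZ']

/-- Flat base change of the subquotient `Z ⧸ L` of `M`, along an identification `e` of `S ⊗ M`
with an `S`-module in which `Z` and `L` generate `Z'` and `L'`. -/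
def subquotientBaseChange [Module.Flat R S] {L Z : Submodule R M} {L' Z' : Submodule S M'}
    (hLZ : L ≤ Z) (e : S ⊗[R] M ≃ₗ[S] M')
    (hL : (L.baseChange S).map (e : S ⊗[R] M →ₗ[S] M') = L')
    (hZ : (Z.baseChange S).map (e : S ⊗[R] M →ₗ[S] M') = Z') :
    S ⊗[R] (Z ⧸ L.submoduleOf Z) ≃ₗ[S] Z' ⧸ L'.submoduleOf Z' :=
  TensorProduct.AlgebraTensorModule.tensorQuotientEquiv S R S (L.submoduleOf Z) ≪≫ₗ
    Submodule.Quotient.equiv ((L.submoduleOf Z).baseChange S) (L'.submoduleOf Z')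
      (submoduleBaseChange e hZ) (map_submoduleBaseChange_submoduleOf hLZ e hL hZ)

end Conjugate

end LinearAlgebra

section Koszul

theorem algebraMap_posSign (R S : Type*) [CommRing R] [CommRing S] [Algebra R S] {l : ℕ}
    (T : Finset (Fin l)) (j : Fin l) : algebraMap R S (posSign R T j) = posSign S T j := by
  simp [posSign]

variable {R : Type*} [CommRing R] {l : ℕ} (x : Fin l → R) (M : Type*) [AddCommGroup M]
  [Module R M]

theorem koszulHomologyMap_eq_zero_iff {m n : ℕ} (h : n ≤ m) (i : ℕ) :
    koszulHomologyMap x M h i = 0 ↔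
      (koszulCycles (fun j => x j ^ m) M i).map (koszulPow x M m n i) ≤
        LinearMap.range (koszulD (fun j => x j ^ n) M i) := by
  rw [Submodule.map_le_iff_le_comap]
  constructor
  · intro h_zero f hf
    have h_mk : (Submodule.Quotient.mk ⟨_, koszulPow_mem_cycles x M h i f hf⟩ :
        KoszulHomology (fun j => x j ^ n) M i) = 0 :=
      LinearMap.congr_fun h_zero (Submodule.Quotient.mk ⟨f, hf⟩)
    rw [Submodule.Quotient.mk_eq_zero] at h_mk
    exact h_mk
  · exact fun hle => Submodule.linearMap_qext _
      (LinearMap.ext fun f => (Submodule.Quotient.mk_eq_zero _).2 (hle f.2))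

variable (S : Type*) [CommRing S] [Algebra R S]

variable (R) in
/-- The isomorphism `S ⊗ K_i(x, M) ≃ K_i(x, S ⊗ M)`. -/
abbrev koszulBaseChange (l i : ℕ) :
    S ⊗[R] (Subsets l i → M) ≃ₗ[S] (Subsets l i → S ⊗[R] M) :=
  TensorProduct.piRight R S S (fun _ : Subsets l i => M)

theorem koszulD_comp_koszulBaseChange (i : ℕ) :
    koszulD (algebraMap R S ∘ x) (S ⊗[R] M) i ∘ₗ koszulBaseChange R M S l (i + 1) =
      koszulBaseChange R M S l i ∘ₗ (koszulD x M i).baseChange S := by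
  refine TensorProduct.AlgebraTensorModule.ext fun s f => funext fun T => ?_
  simp [koszulD_apply, TensorProduct.tmul_sum, ← algebraMap_posSign R S, ← map_mul]

theorem koszulPow_comp_koszulBaseChange (m n i : ℕ) :
    koszulPow (algebraMap R S ∘ x) (S ⊗[R] M) m n i ∘ₗ koszulBaseChange R M S l i =
      koszulBaseChange R M S l i ∘ₗ (koszulPow x M m n i).baseChange S := by
  refine TensorProduct.AlgebraTensorModule.ext fun s f => funext fun T => ?_
  simp [koszulPow, ← map_pow, ← map_prod]

theorem map_baseChange_koszulCycles [Module.Flat R S] (i : ℕ) :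
    ((koszulCycles x M i).baseChange S).map (koszulBaseChange R M S l i).toLinearMap =
      koszulCycles (algebraMap R S ∘ x) (S ⊗[R] M) i := by
  cases i with
  | zero => simp [koszulCycles]
  | succ i => exact map_baseChange_ker (koszulD_comp_koszulBaseChange x M S i)

variable {x M} in
theorem IsWeaklyProregular.baseChange [Module.Flat R S] (hx : IsWeaklyProregular x M) :
    IsWeaklyProregular (algebraMap R S ∘ x) (S ⊗[R] M) := by
  intro n
  obtain ⟨m, hnm, hm⟩ := hx n
  have algebraMap_pow (k : ℕ) :
      (fun j => (algebraMap R S ∘ x) j ^ k) = algebraMap R S ∘ fun j => x j ^ k := by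
    ext j
    simp
  refine ⟨m, hnm, fun i hi => (koszulHomologyMap_eq_zero_iff _ _ _ _).2 ?_⟩
  have h_le := (koszulHomologyMap_eq_zero_iff _ _ _ _).1 (hm i hi)
  rw [algebraMap_pow, algebraMap_pow, ← map_baseChange_koszulCycles,
    ← map_baseChange_range (koszulD_comp_koszulBaseChange _ M S i), ← Submodule.map_comp,
    koszulPow_comp_koszulBaseChange, Submodule.map_comp, ← baseChange_map]
  exact Submodule.map_mono (Submodule.baseChange_mono S h_le)

end Koszul

section Cech

theorem isLocalizedModule_baseChange {R : Type*} [CommRing R] {M N : Type*} [AddCommGroup M]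
    [Module R M] [AddCommGroup N] [Module R N] (p : Submonoid R) (f : M →ₗ[R] N)
    [IsLocalizedModule p f] (S : Type*) [CommRing S] [Algebra R S] :
    IsLocalizedModule (Algebra.algebraMapSubmonoid S p) (f.baseChange S) := by
  have h_comm : (f.baseChange S).restrictScalars R =
      TensorProduct.comm R N S ∘ₗ TensorProduct.AlgebraTensorModule.rTensor R S f ∘ₗ
        TensorProduct.comm R S M :=
    TensorProduct.ext' fun _ _ => rfl
  have : IsLocalizedModule p ((f.baseChange S).restrictScalars R) := by
    rw [h_comm]
    infer_instance
  exact .of_restrictScalars p _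

variable {R : Type*} [CommRing R] {l : ℕ} (x : Fin l → R) (M : Type*) [AddCommGroup M]
  [Module R M]

theorem cechRes_mkLinearMap {U T : Finset (Fin l)} (h : U ⊆ T) (m : M) :
    cechRes x M h (LocalizedModule.mkLinearMap _ M m) = LocalizedModule.mkLinearMap _ M m := by
  simp only [cechRes, LocalizedModule.liftOfLE, IsLocalizedModule.liftOfLE_apply]

variable (S : Type*) [CommRing S] [Algebra R S]

theorem algebraMapSubmonoid_closure_image {ι : Type*} (x : ι → R) (T : Set ι) :
    Algebra.algebraMapSubmonoid S (Submonoid.closure (x '' T)) =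
      Submonoid.closure (algebraMap R S ∘ x '' T) := by
  rw [Algebra.algebraMapSubmonoid, MonoidHom.map_mclosure, Set.image_comp]

theorem isLocalizedModule_cechTerm_baseChange (T : Finset (Fin l)) :
    IsLocalizedModule (Submonoid.closure (algebraMap R S ∘ x '' (T : Set (Fin l))))
      ((LocalizedModule.mkLinearMap (Submonoid.closure (x '' (T : Set (Fin l))))
        M).baseChange S) := by
  rw [← algebraMapSubmonoid_closure_image]
  exact isLocalizedModule_baseChange _ _ S

/-- The isomorphism `S ⊗ M_{x_T} ≃ (S ⊗ M)_{x_T}`. -/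
def cechTermBaseChange (T : Finset (Fin l)) :
    S ⊗[R] CechTerm x M T ≃ₗ[S] CechTerm (algebraMap R S ∘ x) (S ⊗[R] M) T :=
  haveI := isLocalizedModule_cechTerm_baseChange x M S T
  IsLocalizedModule.linearEquiv (Submonoid.closure (algebraMap R S ∘ x '' (T : Set (Fin l))))
    ((LocalizedModule.mkLinearMap _ M).baseChange S) (LocalizedModule.mkLinearMap _ (S ⊗[R] M))

theorem cechTermBaseChange_mkLinearMap (T : Finset (Fin l)) (z : S ⊗[R] M) :
    cechTermBaseChange x M S T ((LocalizedModule.mkLinearMap _ M).baseChange S z) =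
      LocalizedModule.mkLinearMap _ (S ⊗[R] M) z :=
  haveI := isLocalizedModule_cechTerm_baseChange x M S T
  IsLocalizedModule.linearEquiv_apply ..

theorem cechRes_comp_cechTermBaseChange {U T : Finset (Fin l)} (h : U ⊆ T) :
    cechRes (algebraMap R S ∘ x) (S ⊗[R] M) h ∘ₗ cechTermBaseChange x M S U =
      cechTermBaseChange x M S T ∘ₗ (cechRes x M h).baseChange S := by
  have := isLocalizedModule_cechTerm_baseChange x M S U
  have h_le : Submonoid.closure (algebraMap R S ∘ x '' (U : Set (Fin l))) ≤
      Submonoid.closure (algebraMap R S ∘ x '' (T : Set (Fin l))) :=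
    Submonoid.closure_mono (Set.image_mono (Finset.coe_subset.2 h))
  refine IsLocalizedModule.ext (Submonoid.closure (algebraMap R S ∘ x '' (U : Set (Fin l))))
    ((LocalizedModule.mkLinearMap _ M).baseChange S)
    (fun u => IsLocalizedModule.map_units
      (LocalizedModule.mkLinearMap
        (Submonoid.closure (algebraMap R S ∘ x '' (T : Set (Fin l)))) (S ⊗[R] M))
      ⟨u, h_le u.2⟩) ?_
  refine TensorProduct.AlgebraTensorModule.ext fun s m => ?_
  have h_tmul (V : Finset (Fin l)) :
      cechTermBaseChange x M S V (s ⊗ₜ LocalizedModule.mkLinearMap _ M m) =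
        LocalizedModule.mkLinearMap _ (S ⊗[R] M) (s ⊗ₜ m) :=
    cechTermBaseChange_mkLinearMap x M S V (s ⊗ₜ m)
  simp only [LinearMap.comp_apply, LinearEquiv.coe_coe, LinearMap.baseChange_tmul,
    cechRes_mkLinearMap, h_tmul]

/-- The isomorphism `S ⊗ C^i(x; M) ≃ C^i(x; S ⊗ M)`. -/
def cechBaseChange (i : ℕ) :
    S ⊗[R] ((T : Subsets l i) → CechTerm x M T.1) ≃ₗ[S]
      ((T : Subsets l i) → CechTerm (algebraMap R S ∘ x) (S ⊗[R] M) T.1) :=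
  TensorProduct.piRight R S S (fun T : Subsets l i => CechTerm x M T.1) ≪≫ₗ
    LinearEquiv.piCongrRight fun T => cechTermBaseChange x M S T.1

theorem cechBaseChange_tmul (i : ℕ) (s : S) (f : (T : Subsets l i) → CechTerm x M T.1)
    (T : Subsets l i) :
    cechBaseChange x M S i (s ⊗ₜ f) T = cechTermBaseChange x M S T.1 (s ⊗ₜ f T) :=
  rfl

theorem cechD_comp_cechBaseChange (i : ℕ) :
    cechD (algebraMap R S ∘ x) (S ⊗[R] M) i ∘ₗ cechBaseChange x M S i =
      cechBaseChange x M S (i + 1) ∘ₗ (cechD x M i).baseChange S := by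
  refine TensorProduct.AlgebraTensorModule.ext fun s f => funext fun T => ?_
  have h_res {U T : Finset (Fin l)} (h : U ⊆ T) (m : CechTerm x M U) :=
    LinearMap.congr_fun (cechRes_comp_cechTermBaseChange x M S h) (s ⊗ₜ m)
  simp only [LinearMap.comp_apply, LinearEquiv.coe_coe, LinearMap.baseChange_tmul] at h_res
  simp only [LinearMap.comp_apply, LinearEquiv.coe_coe, LinearMap.baseChange_tmul, cechD_apply,
    cechBaseChange_tmul, h_res, TensorProduct.tmul_sum, TensorProduct.tmul_smul, map_sum]
  simp only [← algebraMap_posSign R S, algebraMap_smul]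
  exact Finset.sum_congr rfl fun j _ =>
    ((cechTermBaseChange x M S T.1).toLinearMap.map_smul_of_tower _ _).symm

theorem cechCoboundaries_le_ker (i : ℕ) :
    cechCoboundaries x M i ≤ LinearMap.ker (cechD x M i) := by
  cases i with
  | zero => exact bot_le
  | succ i => exact LinearMap.range_le_ker_iff.2 (cechD_comp x M i)

theorem map_baseChange_cechCoboundaries (i : ℕ) :
    ((cechCoboundaries x M i).baseChange S).map (cechBaseChange x M S i).toLinearMap =
      cechCoboundaries (algebraMap R S ∘ x) (S ⊗[R] M) i := by
  cases i with
  | zero => rw [cechCoboundaries, cechCoboundaries, Submodule.baseChange_bot, Submodule.map_bot]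
  | succ i => exact map_baseChange_range (cechD_comp_cechBaseChange x M S i)

/-- Čech cohomology commutes with flat base change. -/
def cechCohomologyBaseChange [Module.Flat R S] (i : ℕ) :
    S ⊗[R] CechCohomology x M i ≃ₗ[S] CechCohomology (algebraMap R S ∘ x) (S ⊗[R] M) i :=
  subquotientBaseChange (cechCoboundaries_le_ker x M i) (cechBaseChange x M S i)
    (map_baseChange_cechCoboundaries x M S i)
    (map_baseChange_ker (cechD_comp_cechBaseChange x M S i))

end Cech

section Support

variable {R : Type*} [CommRing R] (S : Type*) [CommRing S] [Algebra R S]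

theorem map_rid_baseChange (I : Ideal R) :
    (I.baseChange S).map (TensorProduct.AlgebraTensorModule.rid R S S).toLinearMap =
      I.map (algebraMap R S) := by
  rw [Submodule.baseChange_eq_span, Submodule.map_span, Ideal.map, Ideal.span, Submodule.map_coe,
    Set.image_image]
  simp [Algebra.algebraMap_eq_smul_one]

theorem torsionOf_one_tmul [Module.Flat R S] {N : Type*} [AddCommGroup N] [Module R N] (n : N) :
    Ideal.torsionOf S (S ⊗[R] N) (1 ⊗ₜ n) = (Ideal.torsionOf R N n).map (algebraMap R S) := by
  have h_comm : LinearMap.toSpanSingleton S (S ⊗[R] N) (1 ⊗ₜ n) ∘ₗ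
      (TensorProduct.AlgebraTensorModule.rid R S S).toLinearMap =
        LinearEquiv.refl S (S ⊗[R] N) ∘ₗ (LinearMap.toSpanSingleton R N n).baseChange S := by
    ext
    simp
  rw [← map_rid_baseChange]
  exact (map_baseChange_ker h_comm).symm

theorem support_tensorProduct_of_flat [Module.Flat R S] (N : Type*) [AddCommGroup N]
    [Module R N] :
    Module.support S (S ⊗[R] N) =
      PrimeSpectrum.comap (algebraMap R S) ⁻¹' Module.support R N := by
  have h_span : Submodule.span S (Set.range (TensorProduct.mk R S N 1)) = ⊤ := by
    rw [← LinearMap.coe_range, ← Submodule.map_top, ← Submodule.baseChange_eq_span,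
      Submodule.baseChange_top]
  ext q
  rw [Module.mem_support_iff_of_span_eq_top h_span, Set.mem_preimage,
    Module.mem_support_iff_exists_annihilator, Set.exists_range_iff]
  refine exists_congr fun n => ?_
  rw [TensorProduct.mk_apply, PrimeSpectrum.comap_asIdeal, ← Ideal.map_le_iff_le_comap,
    Ideal.annihilator_span_singleton_eq_torsionOf, Ideal.annihilator_span_singleton_eq_torsionOf,
    torsionOf_one_tmul]

end Support

section RegularSequence

variable {R : Type*} [CommRing R] (S : Type*) [CommRing S] [Algebra R S]
  [Module.FaithfullyFlat R S] {M : Type*} [AddCommGroup M] [Module R M]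

theorem isSMulRegular_of_baseChange {r : R}
    (h : IsSMulRegular (S ⊗[R] M) (algebraMap R S r)) : IsSMulRegular M r := by
  refine (Module.FaithfullyFlat.lTensor_injective_iff_injective R S (LinearMap.lsmul R M r)).1 ?_
  have h_smul : (LinearMap.lsmul R M r).lTensor S = LinearMap.lsmul R (S ⊗[R] M) r := by
    ext
    simp
  rw [h_smul]
  exact (isSMulRegular_algebraMap_iff S).1 h

theorem isWeaklyRegular_of_baseChange {rs : List R}
    (h : RingTheory.Sequence.IsWeaklyRegular (S ⊗[R] M) (rs.map (algebraMap R S))) :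
    RingTheory.Sequence.IsWeaklyRegular M rs := by
  induction rs generalizing M with
  | nil => exact .nil R M
  | cons r rs ih =>
    rw [List.map_cons, RingTheory.Sequence.isWeaklyRegular_cons_iff] at h
    exact .cons (isSMulRegular_of_baseChange S h.1)
      (ih (((QuotSMulTop.algebraMapTensorEquivTensorQuotSMulTop r M S).isWeaklyRegular_congr _).1
        h.2))

theorem ideal_map_smul_top_ne_top_iff (I : Ideal R) :
    I.map (algebraMap R S) • (⊤ : Submodule S (S ⊗[R] M)) ≠ ⊤ ↔ I • (⊤ : Submodule R M) ≠ ⊤ :=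
  (TensorProduct.isBaseChange R M S).map_smul_top_ne_top_iff_of_faithfullyFlat R M I

theorem isRegular_of_baseChange {rs : List R}
    (h : RingTheory.Sequence.IsRegular (S ⊗[R] M) (rs.map (algebraMap R S))) :
    RingTheory.Sequence.IsRegular M rs where
  toIsWeaklyRegular := isWeaklyRegular_of_baseChange S h.toIsWeaklyRegular
  top_ne_smul := by
    have := h.top_ne_smul.symm
    rw [← Ideal.map_ofList] at this
    exact ((ideal_map_smul_top_ne_top_iff S _).1 this).symm

theorem IsRegularSequence.of_baseChange {l : ℕ} {x : Fin l → R}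
    (h : IsRegularSequence (algebraMap R S ∘ x) (S ⊗[R] M)) : IsRegularSequence x M := by
  refine h.imp_right fun h => isRegular_of_baseChange S ?_
  rwa [List.map_ofFn]

end RegularSequence

section ParameterSequence

variable {R : Type*} [CommRing R] (S : Type*) [CommRing S] [Algebra R S]
  {l : ℕ} (x : Fin l → R) (M : Type*) [AddCommGroup M] [Module R M]

theorem seqSMul_baseChange :
    seqSMul (algebraMap R S ∘ x) (S ⊗[R] M) =
      (Ideal.span (Set.range x)).map (algebraMap R S) • ⊤ := by
  rw [seqSMul, Set.range_comp, Ideal.map_span]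

/-- The isomorphism `S ⊗ (M / xM) ≃ (S ⊗ M) / x(S ⊗ M)`. -/
def quotientSeqSMulBaseChange :
    S ⊗[R] (M ⧸ seqSMul x M) ≃ₗ[S] (S ⊗[R] M) ⧸ seqSMul (algebraMap R S ∘ x) (S ⊗[R] M) :=
  (TensorProduct.tensorQuotMapSMulEquivTensorQuot M S (Ideal.span (Set.range x))).symm ≪≫ₗ
    Submodule.quotEquivOfEq _ _ (seqSMul_baseChange S x M).symm

theorem support_quotient_seqSMul_baseChange [Module.Flat R S] :
    Module.support S ((S ⊗[R] M) ⧸ seqSMul (algebraMap R S ∘ x) (S ⊗[R] M)) =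
      PrimeSpectrum.comap (algebraMap R S) ⁻¹' Module.support R (M ⧸ seqSMul x M) := by
  rw [← (quotientSeqSMulBaseChange S x M).support_eq, support_tensorProduct_of_flat]

theorem support_cechCohomology_baseChange [Module.Flat R S] (i : ℕ) :
    Module.support S (CechCohomology (algebraMap R S ∘ x) (S ⊗[R] M) i) =
      PrimeSpectrum.comap (algebraMap R S) ⁻¹' Module.support R (CechCohomology x M i) := by
  rw [← (cechCohomologyBaseChange x M S i).support_eq, support_tensorProduct_of_flat]

variable {x M} [Module.FaithfullyFlat R S]

theorem IsParameterSequence.baseChange (hx : IsParameterSequence x M) :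
    IsParameterSequence (algebraMap R S ∘ x) (S ⊗[R] M) where
  weaklyProregular := hx.weaklyProregular.baseChange S
  ne_top := by
    rw [seqSMul_baseChange]
    exact (ideal_map_smul_top_ne_top_iff S _).2 hx.ne_top
  cech_ne_zero := by
    have h_support : Module.support R (M ⧸ seqSMul x M) ⊆
        Module.support R (CechCohomology x M l) := hx.cech_ne_zero
    change Module.support S _ ⊆ Module.support S _
    rw [support_quotient_seqSMul_baseChange, support_cechCohomology_baseChange]
    exact Set.preimage_mono h_support

theorem IsStrongParameterSequence.baseChange (hx : IsStrongParameterSequence x M) :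
    IsStrongParameterSequence (algebraMap R S ∘ x) (S ⊗[R] M) :=
  fun i hil hi => (hx i hil hi).baseChange S

theorem IsCohenMacaulay.of_faithfullyFlat (h : IsCohenMacaulay S (S ⊗[R] M)) :
    IsCohenMacaulay R M :=
  fun l x hx => (h l (algebraMap R S ∘ x) (hx.baseChange S)).of_baseChange S

end ParameterSequence

section FaithfullyFlat

theorem faithfullyFlat_of_algHom_quotient_maximalIdeal {R : Type*} [CommRing R] [IsLocalRing R]
    {S : Type*} [CommRing S] [Algebra R S] [Module.Flat R S]
    (f : S →ₐ[R] R ⧸ IsLocalRing.maximalIdeal R) :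
    Module.FaithfullyFlat R S where
  submodule_ne_top m hm h_top := by
    obtain rfl := IsLocalRing.eq_maximalIdeal hm
    rw [Ideal.smul_top_eq_map, Submodule.restrictScalars_eq_top_iff] at h_top
    have h_bot : (⊥ : Ideal (R ⧸ IsLocalRing.maximalIdeal R)) = ⊤ := by
      rw [← Ideal.map_quotient_self, ← Ideal.Quotient.algebraMap_eq, ← f.comp_algebraMap,
        ← Ideal.map_map, h_top, Ideal.map_top]
    exact bot_ne_top h_bot

variable (R : Type*) [CommRing R]

theorem faithfullyFlat_adicCompletion [IsLocalRing R]
    [Module.Flat R (AdicCompletion (IsLocalRing.maximalIdeal R) R)] :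
    Module.FaithfullyFlat R (AdicCompletion (IsLocalRing.maximalIdeal R) R) :=
  faithfullyFlat_of_algHom_quotient_maximalIdeal (AdicCompletion.evalOneₐ _)

theorem faithfullyFlat_polynomial : Module.FaithfullyFlat R (Polynomial R) :=
  .of_linearEquiv R _ (Polynomial.basisMonomials R).repr

end FaithfullyFlat

end HMCohenMacaulay

end

theorem mainTheorem7 :
    (∀ (R : Type u) [CommRing R] (S : Type v) [CommRing S] [Algebra R S]
        [Module.FaithfullyFlat R S] (M : Type w) [AddCommGroup M] [Module R M],
        HMCohenMacaulay.IsCohenMacaulay S (S ⊗[R] M) → HMCohenMacaulay.IsCohenMacaulay R M) ∧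
    (∀ (R : Type u) [CommRing R] [IsLocalRing R]
        [Module.Flat R (AdicCompletion (IsLocalRing.maximalIdeal R) R)]
        (M : Type w) [AddCommGroup M] [Module R M],
        HMCohenMacaulay.IsCohenMacaulay (AdicCompletion (IsLocalRing.maximalIdeal R) R)
          (AdicCompletion (IsLocalRing.maximalIdeal R) R ⊗[R] M) →
        HMCohenMacaulay.IsCohenMacaulay R M) ∧
    (∀ (R : Type u) [CommRing R] [IsLocalRing R] [IsNoetherianRing R]
        (M : Type w) [AddCommGroup M] [Module R M],
        HMCohenMacaulay.IsCohenMacaulay (AdicCompletion (IsLocalRing.maximalIdeal R) R)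
          (AdicCompletion (IsLocalRing.maximalIdeal R) R ⊗[R] M) →
        HMCohenMacaulay.IsCohenMacaulay R M) ∧
    (∀ (R : Type u) [CommRing R] (M : Type w) [AddCommGroup M] [Module R M],
        HMCohenMacaulay.IsCohenMacaulay (Polynomial R) (Polynomial R ⊗[R] M) →
        HMCohenMacaulay.IsCohenMacaulay R M) := by
  refine ⟨fun R _ S _ _ _ M _ _ h => h.of_faithfullyFlat S, fun R _ _ _ M _ _ h => ?_,
    fun R _ _ _ M _ _ h => ?_, fun R _ M _ _ h => ?_⟩
  · have := HMCohenMacaulay.faithfullyFlat_adicCompletion R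
    exact h.of_faithfullyFlat _
  · have := HMCohenMacaulay.faithfullyFlat_adicCompletion R
    exact h.of_faithfullyFlat _
  · have := HMCohenMacaulay.faithfullyFlat_polynomial R
    exact h.of_faithfullyFlat _
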